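/- All groups are finite. For a group $G$ with identity $e$, the power graph of $G$ has vertex set $G$, two distinct elements being adjacent iff one is a power of the other. The intersection power graph of $G$ has vertex set $G$; two distinct non-identity elements $x,y$ are adjacent iff $\langle x\rangle\cap\langle y\rangle\neq\{e\}$, and $e$ is adjacent to every other element. The undeleted difference graph of $G$ has vertex set $G$, and its edges are the edges of the intersection power graph that are not edges of the power graph. Let $\mathcal I(G)$ denote its set of isolated vertices, and let $o(g)$ denote the order of $g$. Theorem. Let $G$ be a finite group such that the order of its center $Z(G)$ has at least two distinct prime divisors. Then \[ \mathcal I(G)= \begin{cases} G, & \text{if } G\cong\mathbb Z_{pq} \text{ for distinct primes } p, q;\\ \{g\in G:\langle g\rangle=G\}\cup\{g\in G: o(g)\text{ is prime}\}\cup\{e\}, & \text{if } G\cong\mathbb Z_m \text{ where } m \text{ is not a product of two distinct primes};\\ \{g\in G: o(g)\text{ is prime}\}\cup\{e\}, & \text{otherwise (that is, if } G \text{ is not cyclic)}. \end{cases} \] -/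

import Mathlib

/-- The power graph of `G`: two distinct elements are adjacent iff one of them is a power of
the other. -/
def powerGraph (G : Type*) [Group G] : SimpleGraph G where
  Adj x y := x ≠ y ∧ (x ∈ Subgroup.zpowers y ∨ y ∈ Subgroup.zpowers x)
  symm := ⟨fun _ _ h => ⟨h.1.symm, h.2.symm⟩⟩
  loopless := ⟨fun _ h => h.1 rfl⟩

/-- The intersection power graph of `G`: two distinct non-identity elements are adjacent iff some
non-identity element is a power of both; by convention the identity is adjacent to every other
element. -/
def intersectionPowerGraph (G : Type*) [Group G] : SimpleGraph G where
  Adj x y := x ≠ y ∧ (x = 1 ∨ y = 1 ∨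
    ∃ z : G, z ≠ 1 ∧ z ∈ Subgroup.zpowers x ∧ z ∈ Subgroup.zpowers y)
  symm := ⟨by
    rintro x y ⟨hne, h | h | ⟨z, hz, hx, hy⟩⟩
    · exact ⟨hne.symm, Or.inr (Or.inl h)⟩
    · exact ⟨hne.symm, Or.inl h⟩
    · exact ⟨hne.symm, Or.inr (Or.inr ⟨z, hz, hy, hx⟩)⟩⟩
  loopless := ⟨fun _ h => h.1 rfl⟩

/-- The undeleted difference graph of `G`: vertex set `G` (isolated vertices retained), and edges
those of the intersection power graph that are not edges of the power graph. -/
def undeletedDifferenceGraph (G : Type*) [Group G] : SimpleGraph G :=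
  intersectionPowerGraph G \ powerGraph G

/-- The set of isolated vertices of the undeleted difference graph. -/
def isolatedVertices (G : Type*) [Group G] : Set G :=
  {g | (undeletedDifferenceGraph G).IsIsolated g}

/-- `G ≅ ℤ_m`, the cyclic group of integers modulo `m`. -/
def IsIsoZMod (G : Type*) [Group G] (m : ℕ) : Prop :=
  Nonempty (G ≃* Multiplicative (ZMod m))

/-- `m` is a product of two distinct primes. -/
def IsProductOfTwoDistinctPrimes (m : ℕ) : Prop :=
  ∃ p q : ℕ, p.Prime ∧ q.Prime ∧ p ≠ q ∧ m = p * q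

section

variable {G : Type*} [Group G]

/-! The identity, generators and elements of prime order are isolated in any group; the point is
that an isolated g ≠ 1 of non-prime order generates G. Comparing g with h * w, where h ∈ ⟨g⟩ has
prime order r and w is a commuting s-element, s ≠ r, forces w ∈ ⟨g⟩
(`mem_zpowers_of_commute_of_isIsolated`). As |Z(G)| has two prime divisors, each s leaves a central
element of order r ≠ s, which removes the commuting assumption (`zpowers_eq_top_of_isIsolated`). -/

theorem isIsolated_iff {g : G} :
    (undeletedDifferenceGraph G).IsIsolated g ↔
      ∀ y, (g = 1 ∨ y = 1 ∨
        ∃ z : G, z ≠ 1 ∧ z ∈ Subgroup.zpowers g ∧ z ∈ Subgroup.zpowers y) →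
        g ∈ Subgroup.zpowers y ∨ y ∈ Subgroup.zpowers g := by
  have hadj : ∀ y, (undeletedDifferenceGraph G).Adj g y ↔
      (g ≠ y ∧ (g = 1 ∨ y = 1 ∨
        ∃ z : G, z ≠ 1 ∧ z ∈ Subgroup.zpowers g ∧ z ∈ Subgroup.zpowers y)) ∧
      ¬ (g ≠ y ∧ (g ∈ Subgroup.zpowers y ∨ y ∈ Subgroup.zpowers g)) := fun y => Iff.rfl
  simp only [SimpleGraph.IsIsolated, hadj]
  refine forall_congr' fun y => ?_
  by_cases h : g = y
  · subst h; simp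
  · rw [ne_eq, eq_false h, not_false_eq_true, true_and, true_and, not_and, not_not]

theorem one_mem_isolatedVertices : (1 : G) ∈ isolatedVertices G :=
  isIsolated_iff.2 fun _ _ => Or.inl (one_mem _)

theorem mem_isolatedVertices_of_zpowers_eq_top {g : G} (hg : Subgroup.zpowers g = ⊤) :
    g ∈ isolatedVertices G :=
  isIsolated_iff.2 fun y _ => Or.inr (hg ▸ Subgroup.mem_top y)

/-- A group of prime order is generated by any nontrivial element, so if ⟨g⟩ meets ⟨y⟩ nontrivially
it lies inside it. -/
theorem mem_isolatedVertices_of_prime_orderOf {g : G} (hg : (orderOf g).Prime) :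
    g ∈ isolatedVertices G := by
  refine isIsolated_iff.2 ?_
  rintro y (rfl | rfl | ⟨z, hz, hzg, hzy⟩)
  · exact Or.inl (one_mem _)
  · exact Or.inr (one_mem _)
  · left
    have : Fact (Nat.card (Subgroup.zpowers g)).Prime := ⟨by rwa [Nat.card_zpowers]⟩
    rcases (Subgroup.eq_bot_or_eq_top_of_prime_card
      ((Subgroup.zpowers z).subgroupOf (Subgroup.zpowers g))) with h | h
    · rw [Subgroup.subgroupOf_eq_bot, Subgroup.disjoint_def] at h
      exact absurd (h (Subgroup.mem_zpowers z) hzg) hz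
    · rw [Subgroup.subgroupOf_eq_top] at h
      exact (Subgroup.zpowers_le.2 hzy) (h (Subgroup.mem_zpowers g))

/-- Each of two commuting elements of coprime orders is a power of their product. -/
theorem Commute.mem_zpowers_mul_of_coprime {x y : G} (h : Commute x y)
    (hco : (orderOf x).Coprime (orderOf y)) :
    x ∈ Subgroup.zpowers (x * y) ∧ y ∈ Subgroup.zpowers (x * y) := by
  have key : ∀ x y : G, Commute x y → (orderOf x).Coprime (orderOf y) →
      x ∈ Subgroup.zpowers (x * y) := by
    intro x y h hco
    obtain ⟨m, hm⟩ := exists_pow_eq_self_of_coprime hco.symm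
    have hmem := pow_mem (pow_mem (Subgroup.mem_zpowers (x * y)) (orderOf y)) m
    rwa [h.mul_pow, pow_orderOf_eq_one, mul_one, hm] at hmem
  exact ⟨key x y h hco, h.eq ▸ key y x h.symm hco.symm⟩

/-- A subgroup of a finite group containing all elements of prime power order is everything. -/
theorem Subgroup.eq_top_of_forall_orderOf_prime_pow [Finite G] {H : Subgroup G}
    (hH : ∀ x : G, ∀ s j : ℕ, s.Prime → orderOf x = s ^ j → x ∈ H) : H = ⊤ := by
  suffices ∀ n : ℕ, ∀ x : G, orderOf x = n → x ∈ H from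
    (Subgroup.eq_top_iff' H).2 fun x => this _ x rfl
  intro n
  induction n using Nat.recOnPosPrimePosCoprime with
  | prime_pow p n hp _ => exact fun x hx => hH x p n hp hx
  | zero => exact fun x hx => absurd hx (orderOf_pos x).ne'
  | one => exact fun x hx => orderOf_eq_one_iff.1 hx ▸ one_mem H
  | coprime a b ha hb hab iha ihb =>
    intro x hx
    have hxb : x ^ b ∈ H := iha _ (by
      rw [orderOf_pow_of_dvd (by omega) (hx ▸ dvd_mul_left b a), hx, Nat.mul_div_cancel _ (by omega)])
    have hxa : x ^ a ∈ H := ihb _ (by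
      rw [orderOf_pow_of_dvd (by omega) (hx ▸ dvd_mul_right a b), hx,
        Nat.mul_div_cancel_left _ (by omega)])
    have hbez : x = (x ^ a) ^ a.gcdA b * (x ^ b) ^ a.gcdB b := by
      have := Nat.gcd_eq_gcd_ab a b
      rw [hab] at this
      rw [← zpow_natCast x a, ← zpow_natCast x b, ← zpow_mul, ← zpow_mul, ← zpow_add, ← this]
      simp
    rw [hbez]
    exact mul_mem (zpow_mem hxa _) (zpow_mem hxb _)

/-- An isolated vertex `g` of composite order divisible by a prime `r` contains among its powers
every element of `s`-power order commuting with it, for `s ≠ r`. -/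
theorem mem_zpowers_of_commute_of_isIsolated [Finite G] {g w : G}
    (hg : (undeletedDifferenceGraph G).IsIsolated g) (hp : ¬ (orderOf g).Prime)
    (hc : Commute g w) {r s j : ℕ} (hr : r.Prime) (hs : s.Prime) (hrs : r ≠ s)
    (hrg : r ∣ orderOf g) (hw : orderOf w = s ^ j) : w ∈ Subgroup.zpowers g := by
  rw [isIsolated_iff] at hg
  by_contra hwg
  set h := g ^ (orderOf g / r)
  have hho : orderOf h = r := orderOf_pow_orderOf_div (orderOf_pos g).ne' hrg
  have hhg : h ∈ Subgroup.zpowers g := pow_mem (Subgroup.mem_zpowers g) _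
  have hcop : r.Coprime (s ^ j) := ((Nat.coprime_primes hr hs).2 hrs).pow_right j
  have hchw : Commute h w := hc.pow_left _
  obtain ⟨hhy, hwy⟩ := hchw.mem_zpowers_mul_of_coprime (by rw [hho, hw]; exact hcop)
  have hh1 : h ≠ 1 := fun e => hr.one_lt.ne' (by rw [← hho, e, orderOf_one])
  rcases hg (h * w) (Or.inr (Or.inr ⟨h, hh1, hhg, hhy⟩)) with hgy | hyg
  · obtain ⟨k, hk⟩ := Subgroup.mem_zpowers_iff.1 hgy
    -- The r-th power kills the h-part; g ^ r ≠ 1 since g has order neither 1 nor r. So ⟨g⟩ and ⟨w⟩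
    -- meet nontrivially, and g ∈ ⟨w⟩ would give r ∣ s ^ j.
    have hgr : g ^ r = (w ^ k) ^ r := by
      have h1 : (h ^ k) ^ r = 1 := by
        rw [← zpow_natCast, zpow_comm, zpow_natCast, ← hho, pow_orderOf_eq_one, one_zpow]
      rw [← hk, hchw.mul_zpow, ((hchw.zpow_zpow k k)).mul_pow, h1, one_mul]
    have hgr1 : g ^ r ≠ 1 := fun e => by
      rcases (Nat.dvd_prime hr).1 (orderOf_dvd_of_pow_eq_one e) with h1 | h1
      · exact hr.one_lt.ne' (Nat.dvd_one.1 (h1 ▸ hrg))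
      · exact hp (h1 ▸ hr)
    rcases hg w (Or.inr (Or.inr ⟨g ^ r, hgr1, pow_mem (Subgroup.mem_zpowers g) _,
      hgr ▸ pow_mem (zpow_mem (Subgroup.mem_zpowers w) _) _⟩)) with h1 | h1
    · have := hrg.trans (orderOf_dvd_of_mem_zpowers h1)
      rw [hw] at this
      exact hr.one_lt.ne' (Nat.eq_one_of_dvd_coprimes hcop dvd_rfl this)
    · exact hwg h1
  · exact hwg (Subgroup.zpowers_le.2 hyg hwy)

theorem zpowers_eq_top_of_isIsolated [Finite G]
    (hZ : 2 ≤ (Nat.card (Subgroup.center G)).primeFactors.card) {g : G}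
    (hg : (undeletedDifferenceGraph G).IsIsolated g) (hg1 : g ≠ 1)
    (hp : ¬ (orderOf g).Prime) : Subgroup.zpowers g = ⊤ := by
  obtain ⟨p, hpm, q, hqm, hpq⟩ := Finset.one_lt_card.1 hZ
  have hcentral : ∀ t ∈ (Nat.card (Subgroup.center G)).primeFactors,
      ∃ a ∈ Subgroup.center G, orderOf a = t := by
    intro t ht
    have : Fact t.Prime := ⟨Nat.prime_of_mem_primeFactors ht⟩
    obtain ⟨a, ha⟩ := exists_prime_orderOf_dvd_card' t (Nat.dvd_of_mem_primeFactors ht)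
    exact ⟨a, a.2, by rw [Subgroup.orderOf_coe, ha]⟩
  -- If t did not divide the order of g, any prime r dividing that order would differ from t, and a
  -- central element of order t would be forced into ⟨g⟩.
  have hdvd : ∀ t ∈ (Nat.card (Subgroup.center G)).primeFactors, t ∣ orderOf g := by
    intro t ht
    by_contra htg
    obtain ⟨a, haZ, ha⟩ := hcentral t ht
    obtain ⟨r, hr, hrg⟩ := Nat.exists_prime_and_dvd (mt orderOf_eq_one_iff.1 hg1)
    have hag : a ∈ Subgroup.zpowers g :=
      mem_zpowers_of_commute_of_isIsolated hg hp (Subgroup.mem_center_iff.1 haZ g) hr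
        (Nat.prime_of_mem_primeFactors ht) (fun e => htg (e ▸ hrg)) hrg (ha.trans (pow_one t).symm)
    exact htg (ha ▸ orderOf_dvd_of_mem_zpowers hag)
  have hne : ∀ s : ℕ, ∃ r ∈ (Nat.card (Subgroup.center G)).primeFactors, r ≠ s := by
    intro s
    by_cases h : p = s
    · exact ⟨q, hqm, fun e => hpq (h.trans e.symm)⟩
    · exact ⟨p, hpm, h⟩
  have hcomm : ∀ (w : G) (s j : ℕ), s.Prime → orderOf w = s ^ j → Commute g w →
      w ∈ Subgroup.zpowers g := by
    intro w s j hs hw hc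
    obtain ⟨r, hr, hrs⟩ := hne s
    exact mem_zpowers_of_commute_of_isIsolated hg hp hc (Nat.prime_of_mem_primeFactors hr) hs hrs
      (hdvd r hr) hw
  refine Subgroup.eq_top_of_forall_orderOf_prime_pow fun w s j hs hw => ?_
  obtain ⟨r, hrm, hrs⟩ := hne s
  have hr := Nat.prime_of_mem_primeFactors hrm
  obtain ⟨a, haZ, ha⟩ := hcentral r hrm
  have hag : a ∈ Subgroup.zpowers g :=
    hcomm a r 1 hr (by rw [ha, pow_one]) (Subgroup.mem_center_iff.1 haZ g)
  have haw : Commute a w := (Subgroup.mem_center_iff.1 haZ w).symm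
  obtain ⟨hay, hwy⟩ := haw.mem_zpowers_mul_of_coprime (by
    rw [ha, hw]; exact ((Nat.coprime_primes hr hs).2 hrs).pow_right j)
  have ha1 : a ≠ 1 := fun e => hr.one_lt.ne' (by rw [← ha, e, orderOf_one])
  rcases isIsolated_iff.1 hg (a * w) (Or.inr (Or.inr ⟨a, ha1, hag, hay⟩)) with hgy | hyg
  -- Here g and w are both powers of a * w, hence commute.
  · refine hcomm w s j hs hw ?_
    obtain ⟨k, hk⟩ := Subgroup.mem_zpowers_iff.1 hgy
    obtain ⟨l, hl⟩ := Subgroup.mem_zpowers_iff.1 hwy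
    have := Commute.zpow_zpow (Commute.refl (a * w)) k l
    rwa [hk, hl] at this
  · exact Subgroup.zpowers_le.2 hyg hwy

theorem isolatedVertices_eq_of_two_le_card_primeFactors_center [Finite G]
    (hZ : 2 ≤ (Nat.card (Subgroup.center G)).primeFactors.card) :
    isolatedVertices G =
      {g : G | Subgroup.zpowers g = ⊤} ∪ {g : G | (orderOf g).Prime} ∪ {1} := by
  ext g
  constructor
  · intro hg
    by_cases h1 : g = 1
    · exact Or.inr h1
    · by_cases hp : (orderOf g).Prime
      · exact Or.inl (Or.inr hp)
      · exact Or.inl (Or.inl (zpowers_eq_top_of_isIsolated hZ hg h1 hp))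
  · rintro ((h | h) | rfl)
    · exact mem_isolatedVertices_of_zpowers_eq_top h
    · exact mem_isolatedVertices_of_prime_orderOf h
    · exact one_mem_isolatedVertices

end

theorem theorem4p2 {G : Type*} [Group G] [Finite G]
    (hZ : 2 ≤ (Nat.card (Subgroup.center G)).primeFactors.card) :
    (∀ m : ℕ, IsIsoZMod G m → IsProductOfTwoDistinctPrimes m →
      isolatedVertices G = Set.univ) ∧
    (∀ m : ℕ, IsIsoZMod G m → ¬ IsProductOfTwoDistinctPrimes m →
      isolatedVertices G =
        {g : G | Subgroup.zpowers g = ⊤} ∪ {g : G | (orderOf g).Prime} ∪ {1}) ∧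
    ((¬ ∃ m : ℕ, IsIsoZMod G m) →
      isolatedVertices G = {g : G | (orderOf g).Prime} ∪ {1}) := by
  have key := isolatedVertices_eq_of_two_le_card_primeFactors_center hZ
  refine ⟨?_, fun _ _ _ => key, fun hG => ?_⟩
  · rintro m ⟨e⟩ ⟨p, q, hp, hq, hpq, rfl⟩
    have hcard : Nat.card G = p * q := by
      rw [Nat.card_congr e.toEquiv, Nat.card_congr Multiplicative.toAdd, Nat.card_zmod]
    rw [key, Set.eq_univ_iff_forall]
    intro g
    obtain ⟨a, b, ha, hb, hab⟩ := exists_dvd_and_dvd_of_dvd_mul (hcard ▸ orderOf_dvd_natCard g)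
    -- The order of g is 1, q, p or p * q, and each value falls in the union.
    rcases (Nat.dvd_prime hp).1 ha with rfl | rfl <;> rcases (Nat.dvd_prime hq).1 hb with rfl | rfl
    · exact Or.inr (orderOf_eq_one_iff.1 (by rw [hab, one_mul]))
    · exact Or.inl (Or.inr (by rw [Set.mem_ofPred_eq, hab, one_mul]; exact hq))
    · exact Or.inl (Or.inr (by rw [Set.mem_ofPred_eq, hab, mul_one]; exact hp))
    · exact Or.inl (Or.inl (Subgroup.eq_top_of_card_eq _ (by rw [Nat.card_zpowers, hab, hcard])))
  · have hempty : {g : G | Subgroup.zpowers g = ⊤} = ∅ := by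
      refine Set.eq_empty_iff_forall_notMem.2 fun g hg => hG ?_
      have : IsCyclic G := ⟨g, (Subgroup.eq_top_iff' _).1 hg⟩
      exact ⟨Nat.card G, ⟨(zmodCyclicMulEquiv this).symm⟩⟩
    rw [key, hempty, Set.empty_union]
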